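/- Let $\mathbb T=\{z\in\mathbb C:|z|=1\}$ be the unit circle with its Borel $\sigma$-algebra and normalized Lebesgue (Haar) measure $m$. For a Borel probability measure $\mu$ on $\mathbb T$ let $\mu^k$ denote its $k$-fold convolution power and $\hat\mu(n)=\int_{\mathbb T} z^{-n}\,d\mu(z)$, $n\in\mathbb Z$, its Fourier–Stieltjes coefficients; $\mu$ is called Rajchman if $\hat\mu(n)\to 0$ as $|n|\to\infty$. For $1\le p\le\infty$ let $P_\mu f(x)=\int_{\mathbb T} f(xy)\,\mu(dy)$ and $Ef=\int_{\mathbb T} f\,dm$ (a constant function), both regarded as bounded operators on the complex space $L_p=L_p(\mathbb T,m)$; let $\|\cdot\|_p$ denote the operator norm on $L_p$ and $\sigma(P_\mu,L_p)$ the spectrum of $P_\mu$ on $L_p$. **Theorem.** Let $\mu$ be a Borel probability measure on $\mathbb T$ such that $\mu^k$ is absolutely continuous with respect to $m$ for some $k\ge 1$. Then $\mu$ is Rajchman, $\|P_\mu^n-E\|_p\to 0$ as $n\to\infty$ for every $1\le p\le\infty$, and $\sigma(P_\mu,L_p)=\sigma(P_\mu,L_2)$ for every $1\le p\le\infty$.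 -/

import Mathlib

open MeasureTheory Filter Topology
open scoped ENNReal

noncomputable section

namespace CircleConv

/-- The unit circle `{z : ℂ | ‖z‖ = 1}` carries its Borel σ-algebra. -/
instance instMeasurableSpaceCircle : MeasurableSpace Circle := borel Circle

instance instBorelSpaceCircle : BorelSpace Circle := ⟨rfl⟩

instance instSecondCountableCircle : SecondCountableTopology Circle :=
  Topology.IsInducing.subtypeVal.secondCountableTopology

/-- Normalized Lebesgue (Haar) measure `m` on the circle. -/
def haar : Measure Circle :=
  Measure.haarMeasure (⊤ : TopologicalSpace.PositiveCompacts Circle)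

instance instIsHaarMeasureHaar : haar.IsHaarMeasure := by
  unfold haar; infer_instance

instance instIsProbabilityMeasureHaar : IsProbabilityMeasure haar :=
  ⟨by simpa [haar] using
    Measure.haarMeasure_self (K₀ := (⊤ : TopologicalSpace.PositiveCompacts Circle))⟩

/-- Convolution powers of a measure on the circle: `μ ^ 0 = δ₁` and `μ ^ (k + 1) = μ ^ k * μ`. -/
def convPow (μ : Measure Circle) : ℕ → Measure Circle
  | 0 => Measure.dirac 1
  | k + 1 => (convPow μ k).mconv μ

/-- Fourier–Stieltjes coefficients `μ̂(n) = ∫ z⁻ⁿ dμ(z)`. -/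
def fourierStieltjes (μ : Measure Circle) (n : ℤ) : ℂ :=
  ∫ z : Circle, ((z : ℂ) ^ (-n)) ∂μ

/-- `μ` is Rajchman if `μ̂(n) → 0` as `|n| → ∞`. -/
def IsRajchman (μ : Measure Circle) : Prop :=
  Tendsto (fourierStieltjes μ) (Filter.comap (fun n : ℤ => |n|) atTop) (𝓝 0)

/-! ### The Markov operator -/

/-- The Markov kernel applied to a function: `(P_μ f)(x) = ∫ f(xy) μ(dy)`. -/
def markovFun (μ : Measure Circle) (f : Circle → ℂ) (x : Circle) : ℂ :=
  ∫ y, f (x * y) ∂μ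

section

variable {μ : Measure Circle} [IsProbabilityMeasure μ] {f g : Circle → ℂ} {p : ℝ≥0∞}

lemma quasi_mul (μ : Measure Circle) [IsProbabilityMeasure μ] :
    Measure.QuasiMeasurePreserving (fun z : Circle × Circle => z.1 * z.2) (haar.prod μ) haar :=
  Measure.quasiMeasurePreserving_fst.comp
    (measurePreserving_mul_prod haar μ).quasiMeasurePreserving

lemma aesm_shift (hf : AEStronglyMeasurable f haar) :
    AEStronglyMeasurable (fun z : Circle × Circle => f (z.1 * z.2)) (haar.prod μ) :=
  hf.comp_quasiMeasurePreserving (quasi_mul μ)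

lemma markovFun_aesm (hf : AEStronglyMeasurable f haar) :
    AEStronglyMeasurable (markovFun μ f) haar :=
  (aesm_shift (μ := μ) hf).integral_prod_right'

lemma ae_shift {q : Circle → Prop} (h : ∀ᵐ x ∂haar, q x) :
    ∀ᵐ x ∂haar, ∀ᵐ y ∂μ, q (x * y) :=
  Measure.ae_ae_of_ae_prod ((quasi_mul μ).ae h)

lemma markovFun_congr (h : f =ᵐ[haar] g) : markovFun μ f =ᵐ[haar] markovFun μ g := by
  filter_upwards [ae_shift (μ := μ) h] with x hx
  exact integral_congr_ae hx

lemma ae_integrable_shift (hp : 1 ≤ p) (hf : MemLp f p haar) :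
    ∀ᵐ x ∂haar, Integrable (fun y => f (x * y)) μ := by
  have h1 : Integrable f haar := hf.integrable hp
  have h2 : Integrable (fun z : Circle × Circle => f z.1) (haar.prod μ) := h1.comp_fst μ
  have h3 : Integrable (fun z : Circle × Circle => f (z.1 * z.2)) (haar.prod μ) :=
    (measurePreserving_mul_prod haar μ).integrable_comp_of_integrable h2
  exact h3.prod_right_ae

/-- `P_μ` does not increase the `L_p` seminorm. -/
lemma eLpNorm_markovFun_le (hp : 1 ≤ p) (hf : AEStronglyMeasurable f haar) :
    eLpNorm (markovFun μ f) p haar ≤ eLpNorm f p haar := by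
  have hsec : ∀ᵐ x ∂haar, AEStronglyMeasurable (fun y => f (x * y)) μ :=
    (aesm_shift (μ := μ) hf).prodMk_left
  rcases eq_or_ne p ∞ with rfl | hpt
  · simp only [eLpNorm_exponent_top]
    refine essSup_le_of_ae_le _ ?_
    filter_upwards [ae_shift (μ := μ) (enorm_ae_le_eLpNormEssSup f haar)] with x hx
    calc ‖markovFun μ f x‖ₑ ≤ ∫⁻ y, ‖f (x * y)‖ₑ ∂μ := enorm_integral_le_lintegral_enorm _
      _ ≤ ∫⁻ _, eLpNormEssSup f haar ∂μ := lintegral_mono_ae hx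
      _ = eLpNormEssSup f haar := by simp
  · have hp0 : p ≠ 0 := (zero_lt_one.trans_le hp).ne'
    have hpos : 0 < p.toReal := ENNReal.toReal_pos hp0 hpt
    rw [eLpNorm_eq_lintegral_rpow_enorm_toReal hp0 hpt,
      eLpNorm_eq_lintegral_rpow_enorm_toReal hp0 hpt]
    refine ENNReal.rpow_le_rpow ?_ (by positivity)
    calc ∫⁻ x, ‖markovFun μ f x‖ₑ ^ p.toReal ∂haar
        ≤ ∫⁻ x, ∫⁻ y, ‖f (x * y)‖ₑ ^ p.toReal ∂μ ∂haar := by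
          refine lintegral_mono_ae ?_
          filter_upwards [hsec] with x hx
          have h1 : ‖markovFun μ f x‖ₑ ≤ eLpNorm (fun y => f (x * y)) p μ := by
            refine le_trans ?_ (eLpNorm_le_eLpNorm_of_exponent_le hp hx)
            rw [eLpNorm_one_eq_lintegral_enorm]
            exact enorm_integral_le_lintegral_enorm _
          calc ‖markovFun μ f x‖ₑ ^ p.toReal
              ≤ (eLpNorm (fun y => f (x * y)) p μ) ^ p.toReal :=
                ENNReal.rpow_le_rpow h1 hpos.le
            _ = ∫⁻ y, ‖f (x * y)‖ₑ ^ p.toReal ∂μ := by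
                rw [eLpNorm_eq_lintegral_rpow_enorm_toReal hp0 hpt, ← ENNReal.rpow_mul,
                  one_div, inv_mul_cancel₀ hpos.ne', ENNReal.rpow_one]
      _ = ∫⁻ y, ∫⁻ x, ‖f (x * y)‖ₑ ^ p.toReal ∂haar ∂μ := by
          refine lintegral_lintegral_swap ?_
          exact (aesm_shift (μ := μ) hf).enorm.pow_const _
      _ = ∫⁻ _, ∫⁻ x, ‖f x‖ₑ ^ p.toReal ∂haar ∂μ := by
          refine lintegral_congr fun y => ?_
          exact lintegral_mul_right_eq_self (fun x => ‖f x‖ₑ ^ p.toReal) y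
      _ = ∫⁻ x, ‖f x‖ₑ ^ p.toReal ∂haar := by simp

lemma markovFun_memLp (hp : 1 ≤ p) (hf : MemLp f p haar) : MemLp (markovFun μ f) p haar :=
  ⟨markovFun_aesm hf.1, (eLpNorm_markovFun_le hp hf.1).trans_lt hf.2⟩

end

/-- The Markov operator `P_μ`, `(P_μ f)(x) = ∫ f(xy) μ(dy)`, as a bounded operator on the complex
space `L_p(𝕋, m)`, `1 ≤ p ≤ ∞`. -/
def markovOp (μ : Measure Circle) [IsProbabilityMeasure μ] (p : ℝ≥0∞) [hp : Fact (1 ≤ p)] :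
    Lp ℂ p haar →L[ℂ] Lp ℂ p haar :=
  LinearMap.mkContinuous
    { toFun := fun f => (markovFun_memLp (μ := μ) hp.out (Lp.memLp f)).toLp (markovFun μ f)
      map_add' := fun f g => by
        rw [← MemLp.toLp_add, MemLp.toLp_eq_toLp_iff]
        refine (markovFun_congr (Lp.coeFn_add f g)).trans ?_
        filter_upwards [ae_integrable_shift (μ := μ) hp.out (Lp.memLp f),
          ae_integrable_shift (μ := μ) hp.out (Lp.memLp g)] with x h1 h2
        exact integral_add h1 h2
      map_smul' := fun c f => by
        rw [RingHom.id_apply, ← MemLp.toLp_const_smul, MemLp.toLp_eq_toLp_iff]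
        refine (markovFun_congr (Lp.coeFn_smul c f)).trans ?_
        filter_upwards with x
        exact integral_smul c _ }
    1 (fun f => by
      rw [one_mul, LinearMap.coe_mk, AddHom.coe_mk, Lp.norm_toLp, Lp.norm_def]
      exact ENNReal.toReal_mono (Lp.eLpNorm_ne_top f)
        (eLpNorm_markovFun_le hp.out (Lp.aestronglyMeasurable f)))

/-- The functional `f ↦ ∫ f dm` on `L_p(𝕋, m)`. -/
def integralFunctional (p : ℝ≥0∞) [hp : Fact (1 ≤ p)] : Lp ℂ p haar →L[ℂ] ℂ :=
  LinearMap.mkContinuous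
    { toFun := fun f => ∫ x, f x ∂haar
      map_add' := fun f g => by
        rw [integral_congr_ae (Lp.coeFn_add f g)]
        exact integral_add ((Lp.memLp f).integrable hp.out) ((Lp.memLp g).integrable hp.out)
      map_smul' := fun c f => by
        rw [integral_congr_ae (Lp.coeFn_smul c f)]
        exact integral_smul c _ }
    1 (fun f => by
      rw [one_mul, LinearMap.coe_mk, AddHom.coe_mk, Lp.norm_def, ← toReal_enorm]
      refine ENNReal.toReal_mono (Lp.eLpNorm_ne_top f) ?_
      refine le_trans ?_
        (eLpNorm_le_eLpNorm_of_exponent_le hp.out (Lp.aestronglyMeasurable f))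
      rw [eLpNorm_one_eq_lintegral_enorm]
      exact enorm_integral_le_lintegral_enorm _)

/-- The expectation `E f = ∫ f dm`, as the operator on `L_p(𝕋, m)` that sends `f` to the constant
function with value `∫ f dm`. -/
def expectationOp (p : ℝ≥0∞) [Fact (1 ≤ p)] : Lp ℂ p haar →L[ℂ] Lp ℂ p haar :=
  (Lp.constL p haar ℂ).comp (integralFunctional p)

end CircleConv

end

/-!
Let `ν = μ ^ k` have density `h`. Approximating `h` in `L_1` by a trigonometric polynomial and using
`‖f * g‖_p ≤ ‖f‖_p ‖g‖₁`, one sees that `P_μ ^ k` is, on every `L_p`, a norm limit of finite linear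
combinations of the rank-one Fourier projections `f ↦ f̂(n) zⁿ`
(`CircleConv.exists_norm_markovOp_sub_le`). These projections are orthogonal idempotents which
commute with `P_μ` and on whose ranges `P_μ` acts as the scalar `μ̂(-n)`
(`CircleConv.isDiagonalOn_markovOp`); the one for `n = 0` is `E`.

All conclusions are then drawn in the Banach algebra of operators on `L_p`, without compactness or
interpolation. Suppose `‖a ^ k - ∑ bᵢ eᵢ‖ ≤ ε` with a finite sum, where `a eᵢ = eᵢ a = cᵢ eᵢ`.

* For `i` outside the sum, `cᵢ ^ k` is an eigenvalue of the remainder, so `|cᵢ| ^ k ≤ ε`; this shows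
  that `μ` is Rajchman (`CircleConv.IsDiagonalOn.tendsto_eigenvalue`).
* Put `q = 1 - ∑ eᵢ`. Then `a ^ (k m) q` equals the `m`-th power of the remainder times `q`, and has
  norm at most `ε ^ m ‖q‖`. Hence `a q` has spectral radius at most `ε ^ (1 / k)`, and the spectrum
  of `a` consists of the `cᵢ` and their limit `0`, which does not depend on `p`
  (`CircleConv.IsDiagonalOn.spectrum_eq`).
* For `ε < 1`, the powers `a ^ n q` tend to `0`, while on the finitely many remaining directions
  `cᵢ ^ n → 0` unless `cᵢ = 1` (`CircleConv.IsDiagonalOn.tendsto_pow`). Here `|μ̂(n)| < 1` for `n ≠ 0`, as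
  otherwise `|μ̂(n m)| = 1` for all `m` (`CircleConv.norm_integral_character_lt_one`).
-/

namespace CircleConv

/-! ### Banach algebra elements diagonalized by orthogonal idempotents -/

section Diagonal

variable {A ι : Type*} [NormedRing A] [NormedAlgebra ℂ A] {a : A} {e : ι → A} {c : ι → ℂ} {k : ℕ}

/-- The `e i` are nonzero, pairwise orthogonal idempotents, and `a` acts on the range of `e i`
as the scalar `c i`, from both sides. The sum of the `e i` need not be `1` in any sense. -/
structure IsDiagonalOn (a : A) (e : ι → A) (c : ι → ℂ) : Prop where
  ne_zero : ∀ i, e i ≠ 0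
  mul_self : ∀ i, e i * e i = e i
  mul_of_ne : ∀ i j, i ≠ j → e i * e j = 0
  left : ∀ i, a * e i = c i • e i
  right : ∀ i, e i * a = c i • e i

namespace IsDiagonalOn

lemma pow_mul_idem (h : IsDiagonalOn a e c) (n : ℕ) (i : ι) : a ^ n * e i = c i ^ n • e i := by
  induction n with
  | zero => simp
  | succ n ih => rw [pow_succ, mul_assoc, h.left, mul_smul_comm, ih, smul_smul, pow_succ, mul_comm]

lemma eigenvalue_mem_spectrum (h : IsDiagonalOn a e c) (i : ι) : c i ∈ spectrum ℂ a := by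
  rw [spectrum.mem_iff]
  intro hu
  have h0 : (algebraMap ℂ A (c i) - a) * e i = 0 := by
    rw [sub_mul, h.left, Algebra.algebraMap_eq_smul_one, smul_mul_assoc, one_mul, sub_self]
  exact h.ne_zero i ((hu.mul_right_eq_zero).1 h0)

/-- If `a ^ k` is a limit of finite linear combinations of the `e i`, then the eigenvalues vanish at
infinity: outside the support of the combination, `c i ^ k` is an eigenvalue of the remainder. -/
lemma tendsto_eigenvalue (h : IsDiagonalOn a e c) (hk : k ≠ 0)
    (happ : ∀ ε > 0, ∃ b : ι →₀ ℂ, ‖a ^ k - ∑ i ∈ b.support, b i • e i‖ ≤ ε) :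
    Tendsto c cofinite (𝓝 0) := by
  rw [Metric.tendsto_nhds]
  intro ε hε
  obtain ⟨b, hb⟩ := happ ((ε / 2) ^ k) (by positivity)
  filter_upwards [b.support.finite_toSet.compl_mem_cofinite] with i hi
  have hF : (a ^ k - ∑ j ∈ b.support, b j • e j) * e i = c i ^ k • e i := by
    rw [sub_mul, h.pow_mul_idem, Finset.sum_mul, Finset.sum_eq_zero, sub_zero]
    intro j hj
    rw [smul_mul_assoc, h.mul_of_ne j i (by rintro rfl; exact hi hj), smul_zero]
  have h1 : ‖c i‖ ^ k * ‖e i‖ ≤ (ε / 2) ^ k * ‖e i‖ := by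
    calc ‖c i‖ ^ k * ‖e i‖ = ‖c i ^ k • e i‖ := by rw [norm_smul, norm_pow]
      _ ≤ _ := by rw [← hF]; exact (norm_mul_le _ _).trans (by gcongr)
  have h2 := le_of_mul_le_mul_right h1 (norm_pos_iff.2 (h.ne_zero i))
  have h3 := le_of_pow_le_pow_left₀ hk (by positivity) h2
  rw [dist_zero_right]
  linarith

variable (s : Finset ι)

lemma mul_compl (h : IsDiagonalOn a e c) {i : ι} (hi : i ∈ s) :
    e i * (1 - ∑ j ∈ s, e j) = 0 := by
  rw [mul_sub, mul_one, Finset.mul_sum, Finset.sum_eq_single i, h.mul_self, sub_self]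
  · exact fun j _ hj => h.mul_of_ne i j hj.symm
  · exact fun h => absurd hi h

lemma compl_mul (h : IsDiagonalOn a e c) {i : ι} (hi : i ∈ s) :
    (1 - ∑ j ∈ s, e j) * e i = 0 := by
  rw [sub_mul, one_mul, Finset.sum_mul, Finset.sum_eq_single i, h.mul_self, sub_self]
  · exact fun j _ hj => h.mul_of_ne j i hj
  · exact fun h => absurd hi h

lemma compl_idem (h : IsDiagonalOn a e c) :
    (1 - ∑ j ∈ s, e j) * (1 - ∑ j ∈ s, e j) = 1 - ∑ j ∈ s, e j := by
  conv_lhs => rw [sub_mul, one_mul, Finset.sum_mul]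
  rw [Finset.sum_eq_zero fun i hi => h.mul_compl s hi, sub_zero]

lemma commute_compl (h : IsDiagonalOn a e c) : Commute a (1 - ∑ j ∈ s, e j) := by
  refine (Commute.one_right a).sub_right (Commute.sum_right _ _ _ fun i _ => ?_)
  exact (h.left i).trans (h.right i).symm

lemma pow_eq (h : IsDiagonalOn a e c) (n : ℕ) :
    a ^ n = ∑ i ∈ s, c i ^ n • e i + a ^ n * (1 - ∑ j ∈ s, e j) := by
  rw [mul_sub, mul_one, Finset.mul_sum, Finset.sum_congr rfl fun i _ => h.pow_mul_idem n i]
  abel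

/-- On the complement of the range of `∑ e i`, `a ^ k` acts as its remainder after subtraction of a
linear combination of the `e i`. -/
lemma pow_pow_mul_compl (h : IsDiagonalOn a e c) (b : ι → ℂ) (m : ℕ) :
    (a ^ k) ^ m * (1 - ∑ j ∈ s, e j) =
      (a ^ k - ∑ i ∈ s, b i • e i) ^ m * (1 - ∑ j ∈ s, e j) := by
  set q := 1 - ∑ j ∈ s, e j with hq
  have hFq : (∑ i ∈ s, b i • e i) * q = 0 := by
    rw [Finset.sum_mul]
    exact Finset.sum_eq_zero fun i hi => by rw [smul_mul_assoc, h.mul_compl s hi, smul_zero]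
  have hqF : q * (∑ i ∈ s, b i • e i) = 0 := by
    rw [Finset.mul_sum]
    exact Finset.sum_eq_zero fun i hi => by rw [mul_smul_comm, h.compl_mul s hi, smul_zero]
  set R := a ^ k - ∑ i ∈ s, b i • e i with hR
  have hRq : R * q = a ^ k * q := by rw [hR, sub_mul, hFq, sub_zero]
  have hcR : R * q = q * R := by
    rw [hRq, hR, mul_sub q, hqF, sub_zero]
    exact ((h.commute_compl s).pow_left k).eq
  induction m with
  | zero => simp
  | succ m ih =>
    rw [pow_succ, mul_assoc, ← hRq, hcR, ← mul_assoc, ih, mul_assoc, ← hcR, ← mul_assoc, ← pow_succ]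

lemma norm_pow_mul_compl_le (h : IsDiagonalOn a e c) (b : ι → ℂ) {m : ℕ} (hm : 0 < m) :
    ‖a ^ (k * m) * (1 - ∑ j ∈ s, e j)‖ ≤
      ‖a ^ k - ∑ i ∈ s, b i • e i‖ ^ m * ‖1 - ∑ j ∈ s, e j‖ := by
  rw [pow_mul, h.pow_pow_mul_compl s b]
  exact (norm_mul_le _ _).trans (by gcongr; exact norm_pow_le' _ hm)

/-- If `a` has norm at most `1`, all its eigenvalues but the eigenvalue `1` of `e i₀` have modulus
less than `1`, and some power of `a` is within distance less than `1` of a linear combination of the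
`e i`, then the powers of `a` converge to `e i₀`. -/
lemma tendsto_pow (h : IsDiagonalOn a e c) (hk : k ≠ 0) (ha : ‖a‖ ≤ 1) {i₀ : ι} (h1 : c i₀ = 1)
    (hlt : ∀ i, i ≠ i₀ → ‖c i‖ < 1) (b : ι →₀ ℂ)
    (hb : ‖a ^ k - ∑ i ∈ b.support, b i • e i‖ < 1) :
    Tendsto (fun n => ‖a ^ n - e i₀‖) atTop (𝓝 0) := by
  classical
  -- `i₀` is added to the support so that `e i₀` is split off in any case.
  set s := insert i₀ b.support with hs
  have hsum : ∑ i ∈ b.support, b i • e i = ∑ i ∈ s, b i • e i :=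
    Finset.sum_subset (Finset.subset_insert _ _) fun i _ hi => by
      rw [Finsupp.notMem_support_iff.1 hi, zero_smul]
  rw [hsum] at hb
  set r := ‖a ^ k - ∑ i ∈ s, b i • e i‖ with hr
  set q := 1 - ∑ j ∈ s, e j with hq
  have hfin : Tendsto (fun n => ∑ i ∈ s, c i ^ n • e i) atTop (𝓝 (e i₀)) := by
    have : e i₀ = ∑ i ∈ s, (if i = i₀ then (1 : ℂ) else 0) • e i := by
      simp [ite_smul, hs]
    rw [this]
    refine tendsto_finsetSum _ fun i _ => Tendsto.smul_const ?_ _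
    split_ifs with hi
    · exact tendsto_const_nhds.congr fun n => by rw [hi, h1, one_pow]
    · exact tendsto_pow_atTop_nhds_zero_of_norm_lt_one (hlt i hi)
  have hrest : Tendsto (fun n => a ^ n * q) atTop (𝓝 0) := by
    have hdiv : Tendsto (fun n : ℕ => n / k) atTop atTop := Nat.tendsto_div_const_atTop hk
    have hlim : Tendsto (fun n : ℕ => r ^ (n / k) * ‖q‖) atTop (𝓝 0) := by
      simpa using ((tendsto_pow_atTop_nhds_zero_of_lt_one (norm_nonneg _) hb).comp hdiv).mul_const ‖q‖
    refine squeeze_zero_norm' ?_ hlim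
    filter_upwards [hdiv.eventually_gt_atTop 0] with n hn
    have hsplit : a ^ n * q = a ^ (n % k) * (a ^ (k * (n / k)) * q) := by
      rw [← mul_assoc, ← pow_add, Nat.mod_add_div]
    have hle := h.norm_pow_mul_compl_le (k := k) s b hn
    -- The case `n % k = 0` is separate because `‖1‖ ≤ 1` is not assumed.
    rcases Nat.eq_zero_or_pos (n % k) with h0 | h0
    · rw [hsplit, h0, pow_zero, one_mul]; exact hle
    · rw [hsplit]
      calc _ ≤ ‖a ^ (n % k)‖ * ‖a ^ (k * (n / k)) * q‖ := norm_mul_le _ _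
        _ ≤ 1 * ‖a ^ (k * (n / k)) * q‖ := by
          gcongr
          exact (norm_pow_le' _ h0).trans (pow_le_one₀ (norm_nonneg _) ha)
        _ ≤ _ := by rw [one_mul]; exact hle
  rw [← tendsto_iff_norm_sub_tendsto_zero]
  have := hfin.add hrest
  rw [add_zero] at this
  exact this.congr fun n => (h.pow_eq s n).symm

variable [CompleteSpace A]

/-- A number that is not among the finitely many eigenvalues `c i`, `i ∈ s`, and whose `k`-th power
exceeds in modulus the norm of a remainder of `a ^ k`, lies in the resolvent set: the inverse of
`z - a` is explicit on the ranges of the `e i`, and on the complement the spectral radius of `a` is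
small. -/
lemma notMem_spectrum (h : IsDiagonalOn a e c) (b : ι → ℂ) {z : ℂ} (hz : ∀ i ∈ s, z ≠ c i)
    (hk : k ≠ 0) (hb : ‖a ^ k - ∑ i ∈ s, b i • e i‖ < ‖z‖ ^ k) : z ∉ spectrum ℂ a := by
  set r := ‖a ^ k - ∑ i ∈ s, b i • e i‖ with hr
  set q := 1 - ∑ j ∈ s, e j with hq
  have hcom : Commute a q := h.commute_compl s
  -- `(a * q) ^ (k * m) = a ^ (k * m) * q` has norm of order `r ^ m`, but `z ^ (k * m)` would be in
  -- its spectrum.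
  have hz0 : 0 < ‖z‖ ^ k := (norm_nonneg _).trans_lt hb
  have hnot : z ∉ spectrum ℂ (a * q) := by
    intro hmem
    have hbound : ∀ m : ℕ, 0 < m → 1 ≤ (r / ‖z‖ ^ k) ^ m * (‖q‖ * ‖(1 : A)‖) := by
      intro m hm
      have hpos : 0 < k * m := by positivity
      have h1 := spectrum.norm_le_norm_mul_of_mem (spectrum.pow_mem_pow (a * q) (k * m) hmem)
      have hqp : q ^ (k * m) = q := IsIdempotentElem.pow_eq (h.compl_idem s) hpos.ne'
      rw [hcom.mul_pow, hqp, norm_pow, pow_mul] at h1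
      have h2 := h.norm_pow_mul_compl_le (k := k) s b hm
      rw [div_pow, div_mul_eq_mul_div, le_div_iff₀ (by positivity), one_mul, ← mul_assoc]
      exact h1.trans (by gcongr)
    have hlim : Tendsto (fun m : ℕ => (r / ‖z‖ ^ k) ^ m * (‖q‖ * ‖(1 : A)‖)) atTop (𝓝 0) := by
      simpa using (tendsto_pow_atTop_nhds_zero_of_lt_one (by positivity)
        ((div_lt_one hz0).2 hb)).mul_const (‖q‖ * ‖(1 : A)‖)
    have := ge_of_tendsto hlim ((eventually_gt_atTop 0).mono hbound)
    linarith
  rw [spectrum.notMem_iff] at hnot ⊢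
  -- `u = z - a * q` agrees with `z - a` on the range of `q`.
  obtain ⟨u, hu⟩ := hnot
  have hqu : Commute q (u : A) := by
    rw [hu]
    refine Commute.sub_right (Algebra.commutes z q).symm ?_
    exact hcom.symm.mul_right (Commute.refl q)
  have hzq : (algebraMap ℂ A z - a) * q = u * q := by
    rw [hu, sub_mul, sub_mul, mul_assoc, h.compl_idem s]
  have hqz : q * (algebraMap ℂ A z - a) = q * u := by
    rw [hqu.eq, ← hzq]
    exact (Commute.sub_right (Algebra.commutes z q).symm hcom.symm : Commute q _).eq
  have hone : ∑ i ∈ s, e i + q = 1 := by rw [hq]; abel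
  refine isUnit_iff_exists.2 ⟨∑ i ∈ s, (z - c i)⁻¹ • e i + q * ↑u⁻¹, ?_, ?_⟩
  · rw [mul_add, ← mul_assoc, hzq, ← hqu.eq, mul_assoc, Units.mul_inv, mul_one, Finset.mul_sum,
      ← hone]
    congr 1
    refine Finset.sum_congr rfl fun i hi => ?_
    rw [mul_smul_comm, sub_mul, h.left, Algebra.algebraMap_eq_smul_one, smul_mul_assoc, one_mul,
      ← sub_smul, smul_smul, inv_mul_cancel₀ (sub_ne_zero.2 (hz i hi)), one_smul]
  · rw [add_mul, hqu.units_inv_right.eq, mul_assoc, hqz, hqu.eq, ← mul_assoc, Units.inv_mul,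
      one_mul, Finset.sum_mul, ← hone]
    congr 1
    refine Finset.sum_congr rfl fun i hi => ?_
    rw [smul_mul_assoc, mul_sub, h.right, Algebra.algebraMap_eq_smul_one, mul_smul_comm, mul_one,
      ← sub_smul, smul_smul, inv_mul_cancel₀ (sub_ne_zero.2 (hz i hi)), one_smul]

/-- If a power of `a` is a limit of linear combinations of infinitely many orthogonal idempotents,
the spectrum of `a` consists of its eigenvalues and of their limit `0`. -/
lemma spectrum_eq [Infinite ι] (h : IsDiagonalOn a e c) (hk : k ≠ 0)
    (happ : ∀ ε > 0, ∃ b : ι →₀ ℂ, ‖a ^ k - ∑ i ∈ b.support, b i • e i‖ ≤ ε) :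
    spectrum ℂ a = insert 0 (Set.range c) := by
  refine Set.Subset.antisymm (fun z hz => ?_) (Set.insert_subset ?_ ?_)
  · by_contra hne
    rw [Set.mem_insert_iff, not_or] at hne
    have hpos : 0 < ‖z‖ ^ k := pow_pos (norm_pos_iff.2 hne.1) k
    obtain ⟨b, hb⟩ := happ (‖z‖ ^ k / 2) (by positivity)
    refine h.notMem_spectrum b.support b (fun i _ hi => hne.2 ⟨i, hi.symm⟩) hk ?_ hz
    linarith
  · exact (spectrum.isClosed a).mem_of_tendsto (h.tendsto_eigenvalue hk happ)
      (Eventually.of_forall h.eigenvalue_mem_spectrum)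
  · rintro _ ⟨i, rfl⟩
    exact h.eigenvalue_mem_spectrum i

end IsDiagonalOn

end Diagonal

/-! ### Characters and trigonometric polynomials -/

/-- The character `z ↦ z ^ n` of the circle, as a continuous complex-valued function. -/
noncomputable def character (n : ℤ) : C(Circle, ℂ) where
  toFun z := (z : ℂ) ^ n
  continuous_toFun := by
    simp_rw [← Circle.coe_zpow]
    exact continuous_subtype_val.comp (continuous_zpow n)

lemma character_apply (n : ℤ) (z : Circle) : character n z = (z : ℂ) ^ n := rfl

lemma norm_character (n : ℤ) (z : Circle) : ‖character n z‖ = 1 := by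
  rw [character_apply, norm_zpow, Circle.norm_coe, one_zpow]

lemma character_mul (n : ℤ) (z w : Circle) :
    character n (z * w) = character n z * character n w := by
  simp [character_apply, mul_zpow]

lemma character_add (m n : ℤ) (z : Circle) :
    character (m + n) z = character m z * character n z :=
  zpow_add₀ (Circle.coe_ne_zero z) m n

lemma integrable_character {ν : Measure Circle} [IsFiniteMeasure ν] (n : ℤ) :
    Integrable (character n) ν :=
  (character n).continuous.integrable_of_hasCompactSupport (HasCompactSupport.of_compactSpace _)

/-- Translation by a point `w` with `wⁿ = -1` changes the sign of the integral. -/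
lemma integral_character_haar {n : ℤ} (hn : n ≠ 0) : ∫ z, character n z ∂haar = 0 := by
  have hpi : (Circle.exp (Real.pi / n) : ℂ) ^ n = -1 := by
    rw [← Circle.coe_zpow, ← Circle.exp_zsmul, zsmul_eq_mul,
      mul_div_cancel₀ _ (by exact_mod_cast hn)]
    simp
  have h := integral_mul_left_eq_self (μ := haar) (fun z => character n z) (Circle.exp (Real.pi / n))
  simp_rw [character_mul] at h
  rw [integral_const_mul, character_apply, hpi] at h
  linear_combination (-1 / 2) * h

/-- Stone–Weierstrass, transferred from the additive circle. The frequencies are negated because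
convolution with `y ↦ y⁻ⁿ` against `f (x * y)` gives the `n`-th Fourier projection. -/
lemma exists_trigPoly_near_continuous (f : C(Circle, ℂ)) {ε : ℝ} (hε : 0 < ε) :
    ∃ b : ℤ →₀ ℂ, ∀ z, ‖f z - ∑ n ∈ b.support, b n * character (-n) z‖ ≤ ε := by
  have : Fact (0 < 2 * Real.pi) := ⟨Real.two_pi_pos⟩
  let φ := AddCircle.homeomorphCircle (T := 2 * Real.pi) Real.two_pi_pos.ne'
  have hmem : f.comp (φ : C(AddCircle (2 * Real.pi), Circle)) ∈
      (Submodule.span ℂ (Set.range fun n : ℤ =>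
        fourier (T := 2 * Real.pi) (-n))).topologicalClosure := by
    have : (Set.range fun n : ℤ => fourier (T := 2 * Real.pi) (-n)) = Set.range fourier :=
      neg_surjective.range_comp fourier
    rw [this, span_fourier_closure_eq_top]
    trivial
  obtain ⟨g, hg, hgε⟩ := Metric.mem_closure_iff.1 hmem ε hε
  obtain ⟨b, rfl⟩ := (Finsupp.mem_span_range_iff_exists_finsupp).1 hg
  refine ⟨b, fun z => ?_⟩
  obtain ⟨x, rfl⟩ := φ.surjective z
  rw [dist_eq_norm] at hgε
  refine le_trans (le_of_eq ?_) ((ContinuousMap.norm_coe_le_norm _ x).trans hgε.le)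
  have key : ∀ n : ℤ, fourier n x = character n (φ x) := fun n => by
    rw [fourier_apply, AddCircle.toCircle_zsmul, Circle.coe_zpow, character_apply,
      AddCircle.homeomorphCircle_apply]
  simp only [Finsupp.sum, ContinuousMap.sub_apply, ContinuousMap.sum_apply, ContinuousMap.smul_apply,
    key, smul_eq_mul, ContinuousMap.comp_apply, ContinuousMap.coe_coe]

/-- Trigonometric polynomials are dense in `L_1`. -/
lemma exists_trigPoly_near_integrable {h : Circle → ℂ} (hh : Integrable h haar) {ε : ℝ}
    (hε : 0 < ε) :
    ∃ b : ℤ →₀ ℂ, ∫ z, ‖h z - ∑ n ∈ b.support, b n * character (-n) z‖ ∂haar ≤ ε := by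
  obtain ⟨g, hg, hgi⟩ := hh.exists_boundedContinuous_integral_sub_le (half_pos hε)
  obtain ⟨b, hb⟩ := exists_trigPoly_near_continuous g.toContinuousMap (half_pos hε)
  refine ⟨b, ?_⟩
  have hle : ∀ z, ‖h z - ∑ n ∈ b.support, b n * character (-n) z‖ ≤ ‖h z - g z‖ + ε / 2 := fun z =>
    (norm_sub_le_norm_sub_add_norm_sub _ (g z) _).trans (by gcongr; exact hb z)
  have hi : Integrable (fun z => ‖h z - g z‖) haar := (hh.sub hgi).norm
  calc _ ≤ ∫ z, (‖h z - g z‖ + ε / 2) ∂haar :=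
        integral_mono_of_nonneg (Eventually.of_forall fun _ => norm_nonneg _)
          (hi.add (integrable_const _)) (Eventually.of_forall hle)
    _ = ∫ z, ‖h z - g z‖ ∂haar + ε / 2 := by
        rw [integral_add hi (integrable_const _)]; simp
    _ ≤ ε := by linarith

/-! ### Fourier projections -/

section Projection

variable (p : ℝ≥0∞) [hp : Fact (1 ≤ p)]

/-- The character `z ↦ z ^ n` as an element of `L_p(𝕋, m)`. -/
noncomputable def characterLp (n : ℤ) : Lp ℂ p haar := ContinuousMap.toLp p haar ℂ (character n)

lemma coeFn_characterLp (n : ℤ) : characterLp p n =ᵐ[haar] character n :=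
  ContinuousMap.coeFn_toLp haar (character n)

lemma integrable_mul_character {ν : Measure Circle} [IsFiniteMeasure ν] {f : Circle → ℂ}
    (hf : Integrable f ν) (n : ℤ) : Integrable (fun z => f z * character n z) ν :=
  hf.mul_bdd (c := 1) (character n).continuous.aestronglyMeasurable
    (Eventually.of_forall fun z => (norm_character n z).le)

lemma integrable_coeFn (f : Lp ℂ p haar) : Integrable f haar := (Lp.memLp f).integrable hp.out

/-- The `n`-th Fourier coefficient `f ↦ ∫ f(z) z⁻ⁿ dm(z)`, as a functional on `L_p(𝕋, m)`. -/
noncomputable def coeffFunctional (n : ℤ) : Lp ℂ p haar →L[ℂ] ℂ :=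
  LinearMap.mkContinuous
    { toFun := fun f => ∫ z, f z * character (-n) z ∂haar
      map_add' := fun f g => by
        rw [← integral_add (integrable_mul_character (integrable_coeFn p f) _)
          (integrable_mul_character (integrable_coeFn p g) _)]
        refine integral_congr_ae ?_
        filter_upwards [Lp.coeFn_add f g] with z hz
        rw [hz, Pi.add_apply, add_mul]
      map_smul' := fun r f => by
        rw [RingHom.id_apply, ← integral_smul]
        refine integral_congr_ae ?_
        filter_upwards [Lp.coeFn_smul r f] with z hz
        rw [hz, Pi.smul_apply, smul_mul_assoc] }
    1 (fun f => by
      rw [one_mul, LinearMap.coe_mk, AddHom.coe_mk, Lp.norm_def, ← toReal_enorm]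
      refine ENNReal.toReal_mono (Lp.eLpNorm_ne_top f) ?_
      refine le_trans ?_ (eLpNorm_le_eLpNorm_of_exponent_le hp.out (Lp.aestronglyMeasurable f))
      rw [eLpNorm_one_eq_lintegral_enorm]
      refine (enorm_integral_le_lintegral_enorm _).trans (lintegral_mono fun z => ?_)
      have h1 : ‖character (-n) z‖ₑ = 1 := by
        rw [← ofReal_norm, norm_character, ENNReal.ofReal_one]
      rw [enorm_mul, h1, mul_one])

lemma coeffFunctional_apply (n : ℤ) (f : Lp ℂ p haar) :
    coeffFunctional p n f = ∫ z, f z * character (-n) z ∂haar := rfl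

/-- The rank-one projection `f ↦ f̂(n) zⁿ` of `L_p(𝕋, m)` onto the line spanned by a character. -/
noncomputable def fourierProj (n : ℤ) : Lp ℂ p haar →L[ℂ] Lp ℂ p haar :=
  (coeffFunctional p n).smulRight (characterLp p n)

lemma fourierProj_apply (n : ℤ) (f : Lp ℂ p haar) :
    fourierProj p n f = coeffFunctional p n f • characterLp p n := rfl

lemma coeffFunctional_characterLp (m n : ℤ) :
    coeffFunctional p m (characterLp p n) = if m = n then 1 else 0 := by
  have h : coeffFunctional p m (characterLp p n) = ∫ z, character (n - m) z ∂haar := by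
    rw [coeffFunctional_apply]
    refine integral_congr_ae ?_
    filter_upwards [coeFn_characterLp p n] with z hz
    rw [hz, sub_eq_add_neg, character_add]
  rw [h]
  split_ifs with hmn
  · simp [hmn, character_apply]
  · exact integral_character_haar (sub_ne_zero.2 (Ne.symm hmn))

lemma characterLp_ne_zero (n : ℤ) : characterLp p n ≠ 0 := by
  intro h
  have := coeffFunctional_characterLp p n n
  rw [h, map_zero, if_pos rfl] at this
  exact zero_ne_one this

lemma fourierProj_zero : fourierProj p 0 = expectationOp p := by
  ext1 f
  have h1 : characterLp p 0 = Lp.const p haar (1 : ℂ) := by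
    apply Lp.ext
    filter_upwards [coeFn_characterLp p 0, Lp.coeFn_const p haar (1 : ℂ)] with z h1 h2
    rw [h1, h2, character_apply, zpow_zero]; rfl
  have h2 : coeffFunctional p 0 f = integralFunctional p f := by
    rw [coeffFunctional_apply]
    simp only [neg_zero, character_apply, zpow_zero, mul_one]
    rfl
  rw [fourierProj_apply, h1, h2]
  change _ = Lp.constL p haar ℂ (integralFunctional p f)
  rw [show Lp.const p haar (1 : ℂ) = Lp.constL p haar ℂ (1 : ℂ) from rfl, ← map_smul, smul_eq_mul,
    mul_one]

end Projection

/-! ### The Markov operator: characters and convolution powers -/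

section Markov

variable (μ : Measure Circle) [IsProbabilityMeasure μ] (p : ℝ≥0∞) [hp : Fact (1 ≤ p)]

lemma coeFn_markovOp (f : Lp ℂ p haar) : markovOp μ p f =ᵐ[haar] markovFun μ f :=
  MemLp.coeFn_toLp (markovFun_memLp (μ := μ) hp.out (Lp.memLp f))

lemma norm_markovOp_le : ‖markovOp μ p‖ ≤ 1 :=
  LinearMap.mkContinuous_norm_le _ zero_le_one _

lemma fourierStieltjes_neg (ν : Measure Circle) (n : ℤ) :
    fourierStieltjes ν (-n) = ∫ z, character n z ∂ν := by
  simp [fourierStieltjes, character_apply]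

lemma markovOp_characterLp (n : ℤ) :
    markovOp μ p (characterLp p n) = fourierStieltjes μ (-n) • characterLp p n := by
  apply Lp.ext
  filter_upwards [coeFn_markovOp μ p (characterLp p n),
    markovFun_congr (μ := μ) (coeFn_characterLp p n), coeFn_characterLp p n,
    Lp.coeFn_smul (fourierStieltjes μ (-n)) (characterLp p n)] with x h1 h2 h3 h4
  rw [h1, h2, h4, Pi.smul_apply, h3, markovFun, fourierStieltjes_neg]
  simp_rw [character_mul]
  rw [integral_const_mul, smul_eq_mul, mul_comm]

lemma coeffFunctional_markovOp (n : ℤ) (f : Lp ℂ p haar) :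
    coeffFunctional p n (markovOp μ p f) = fourierStieltjes μ (-n) * coeffFunctional p n f := by
  have hint : Integrable (fun z : Circle × Circle => f (z.1 * z.2) * character (-n) z.1)
      (haar.prod μ) := by
    have h3 : Integrable (fun z : Circle × Circle => f (z.1 * z.2)) (haar.prod μ) :=
      (measurePreserving_mul_prod haar μ).integrable_comp_of_integrable
        ((integrable_coeFn p f).comp_fst μ)
    exact h3.mul_bdd (c := 1)
      ((character (-n)).continuous.comp continuous_fst).aestronglyMeasurable
      (Eventually.of_forall fun z => (norm_character (-n) z.1).le)
  calc coeffFunctional p n (markovOp μ p f)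
      = ∫ x, ∫ y, f (x * y) * character (-n) x ∂μ ∂haar := by
        rw [coeffFunctional_apply]
        refine integral_congr_ae ?_
        filter_upwards [coeFn_markovOp μ p f] with x hx
        rw [hx, markovFun, integral_mul_const]
    _ = ∫ y, ∫ x, f (x * y) * character (-n) x ∂haar ∂μ := integral_integral_swap hint
    _ = ∫ y, character n y * coeffFunctional p n f ∂μ := by
        refine integral_congr_ae (Eventually.of_forall fun y => ?_)
        have hcancel : ∀ x : Circle, f (x * y) * character (-n) x =
            character n y * (f (x * y) * character (-n) (x * y)) := fun x => by
          have : character n y * character (-n) y = 1 := by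
            rw [← character_add, add_neg_cancel, character_apply, zpow_zero]
          rw [character_mul]
          linear_combination -(f (x * y) * character (-n) x) * this
        simp_rw [hcancel]
        rw [integral_const_mul, coeffFunctional_apply]
        congr 1
        exact integral_mul_right_eq_self (fun x => f x * character (-n) x) y
    _ = _ := by rw [integral_mul_const, fourierStieltjes_neg]

/-- The Fourier projections diagonalize the Markov operator; its eigenvalues are the
Fourier–Stieltjes coefficients. -/
lemma isDiagonalOn_markovOp :
    IsDiagonalOn (markovOp μ p) (fourierProj p) (fun n => fourierStieltjes μ (-n)) where
  ne_zero n h := by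
    have h1 : fourierProj p n (characterLp p n) = 0 := by rw [h]; rfl
    rw [fourierProj_apply, coeffFunctional_characterLp, if_pos rfl, one_smul] at h1
    exact characterLp_ne_zero p n h1
  mul_self n := by
    ext1 f
    simp [fourierProj_apply, coeffFunctional_characterLp]
  mul_of_ne m n hmn := by
    ext1 f
    simp [fourierProj_apply, coeffFunctional_characterLp, hmn]
  left n := by
    ext1 f
    simp [fourierProj_apply, markovOp_characterLp, smul_smul,
      mul_comm]
  right n := by
    ext1 f
    simp [fourierProj_apply, coeffFunctional_markovOp, smul_smul]

lemma markovOp_mconv (ν : Measure Circle) [IsProbabilityMeasure ν] :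
    markovOp (ν.mconv μ) p = markovOp ν p * markovOp μ p := by
  ext1 f
  apply Lp.ext
  filter_upwards [coeFn_markovOp (ν.mconv μ) p f, coeFn_markovOp ν p (markovOp μ p f),
    markovFun_congr (μ := ν) (coeFn_markovOp μ p f),
    ae_integrable_shift (μ := ν.mconv μ) hp.out (Lp.memLp f)] with x h1 h2 h3 h4
  rw [mul_apply_eq_comp, h1, h2, h3, markovFun, markovFun, integral_mconv h4]
  simp [markovFun, mul_assoc]

lemma markovOp_dirac_one : markovOp (Measure.dirac 1) p = 1 := by
  ext1 f
  apply Lp.ext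
  filter_upwards [coeFn_markovOp (Measure.dirac 1) p f] with x h1
  rw [h1, markovFun, integral_dirac, mul_one, one_apply_eq_self]

instance isProbabilityMeasure_convPow (k : ℕ) : IsProbabilityMeasure (convPow μ k) := by
  induction k with
  | zero => unfold convPow; infer_instance
  | succ k ih => unfold convPow; infer_instance

lemma markovOp_convPow (k : ℕ) : markovOp (convPow μ k) p = markovOp μ p ^ k := by
  induction k with
  | zero => rw [pow_zero]; exact markovOp_dirac_one p
  | succ k ih => rw [pow_succ, ← ih]; exact markovOp_mconv μ p (convPow μ k)

end Markov

/-! ### Convolution with a summable density -/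

section Density

variable (p : ℝ≥0∞) [hp : Fact (1 ≤ p)]

/-- Young's inequality `‖f * g‖_p ≤ ‖f‖_p ‖g‖₁`. It follows from the contractivity of the Markov
operator of the probability measure with density proportional to `|g|`, applied to `|f|`. -/
lemma norm_le_of_ae_eq_integral_mul {f F : Lp ℂ p haar} {g : Circle → ℂ} (hg : Integrable g haar)
    (hF : F =ᵐ[haar] fun x => ∫ y, f (x * y) * g y ∂haar) :
    ‖F‖ ≤ (∫ y, ‖g y‖ ∂haar) * ‖f‖ := by
  set r := ∫ y, ‖g y‖ ∂haar with hr
  have hr0 : 0 ≤ r := integral_nonneg fun _ => norm_nonneg _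
  rcases hr0.eq_or_lt with h0 | hpos
  · have hg0 : g =ᵐ[haar] 0 := by
      have := (integral_eq_zero_iff_of_nonneg (fun _ => norm_nonneg _) hg.norm).1 h0.symm
      filter_upwards [this] with x hx
      simpa using hx
    have hF0 : F = 0 := by
      apply Lp.ext
      filter_upwards [hF, Lp.coeFn_zero ℂ p haar] with x h1 h2
      rw [h1, h2, Pi.zero_apply]
      refine integral_eq_zero_of_ae ?_
      filter_upwards [hg0] with y hy
      simp [hy]
    rw [hF0, norm_zero, ← h0, zero_mul]
  set d : Circle → ℝ≥0∞ := fun y => ENNReal.ofReal (‖g y‖ / r) with hd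
  have hdm : AEMeasurable d haar :=
    (hg.aestronglyMeasurable.norm.aemeasurable.div_const r).ennreal_ofReal
  have hprob : IsProbabilityMeasure (haar.withDensity d) := by
    constructor
    rw [withDensity_apply _ MeasurableSet.univ, Measure.restrict_univ,
      ← ofReal_integral_eq_lintegral_ofReal (hg.norm.div_const r)
        (Eventually.of_forall fun _ => by positivity), integral_div, ← hr, div_self hpos.ne',
      ENNReal.ofReal_one]
  have hf := (Lp.memLp f).norm.ofReal (K := ℂ)
  have hle : ∀ᵐ x ∂haar, ‖F x‖ ≤
      r * ‖markovFun (haar.withDensity d) (fun z => ((‖f z‖ : ℝ) : ℂ)) x‖ := by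
    filter_upwards [hF] with x hx
    have h1 : markovFun (haar.withDensity d) (fun z => ((‖f z‖ : ℝ) : ℂ)) x =
        ((r⁻¹ * ∫ y, ‖f (x * y) * g y‖ ∂haar : ℝ) : ℂ) := by
      rw [markovFun, integral_complex_ofReal, integral_withDensity_eq_integral_toReal_smul₀ hdm
        (Eventually.of_forall fun _ => ENNReal.ofReal_lt_top), ← integral_const_mul]
      congr 2
      ext y
      rw [hd, ENNReal.toReal_ofReal (by positivity), smul_eq_mul, norm_mul]
      ring
    have hnn : 0 ≤ ∫ y, ‖f (x * y) * g y‖ ∂haar := integral_nonneg fun _ => norm_nonneg _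
    rw [h1, Complex.norm_real, Real.norm_of_nonneg (by positivity), mul_inv_cancel_left₀ hpos.ne',
      hx]
    exact norm_integral_le_integral_norm _
  have h2 := eLpNorm_le_mul_eLpNorm_of_ae_le_mul hle p
  have h3 : eLpNorm F p haar ≤ ENNReal.ofReal r * eLpNorm f p haar := by
    refine h2.trans ?_
    gcongr
    refine (eLpNorm_markovFun_le hp.out hf.1).trans (le_of_eq ?_)
    exact eLpNorm_congr_norm_ae (Eventually.of_forall fun x => by simp)
  rw [Lp.norm_def, Lp.norm_def, ← ENNReal.toReal_ofReal hr0, ← ENNReal.toReal_mul]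
  exact ENNReal.toReal_mono (ENNReal.mul_ne_top ENNReal.ofReal_ne_top (Lp.eLpNorm_ne_top f)) h3

lemma coeFn_sum_fourierProj (b : ℤ →₀ ℂ) (f : Lp ℂ p haar) :
    (∑ n ∈ b.support, b n • fourierProj p n) f =ᵐ[haar]
      fun x => ∑ n ∈ b.support, b n * (coeffFunctional p n f * character n x) := by
  have h1 : (∑ n ∈ b.support, b n • fourierProj p n) f =
      ContinuousMap.toLp p haar ℂ
        (∑ n ∈ b.support, b n • coeffFunctional p n f • character n) := by
    simp [fourierProj_apply, characterLp]
  rw [h1]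
  filter_upwards [ContinuousMap.coeFn_toLp (p := p) (𝕜 := ℂ) haar
    (∑ n ∈ b.support, b n • coeffFunctional p n f • character n)] with x hx
  rw [hx]
  simp [ContinuousMap.sum_apply]

/-- Convolution of `f` with a character is a Fourier projection. -/
lemma integral_shift_mul_character (f : Lp ℂ p haar) (n : ℤ) (x : Circle) :
    ∫ y, f (x * y) * character (-n) y ∂haar = coeffFunctional p n f * character n x := by
  have hcancel : ∀ y : Circle, f (x * y) * character (-n) y =
      (f (x * y) * character (-n) (x * y)) * character n x := fun y => by
    have : character n x * character (-n) x = 1 := by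
      rw [← character_add, add_neg_cancel, character_apply, zpow_zero]
    rw [character_mul]
    linear_combination -(f (x * y) * character (-n) y) * this
  simp_rw [hcancel]
  rw [integral_mul_const, coeffFunctional_apply]
  congr 1
  exact integral_mul_left_eq_self (fun y => f y * character (-n) y) x

end Density

/-- The Markov operator of an absolutely continuous measure is a norm limit of finite combinations
of Fourier projections, uniformly in `p`: approximate the density in `L_1` by a trigonometric
polynomial. -/
lemma exists_norm_markovOp_sub_le (ν : Measure Circle) [IsProbabilityMeasure ν] (hν : ν ≪ haar)
    {ε : ℝ} (hε : 0 < ε) :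
    ∃ b : ℤ →₀ ℂ, ∀ (p : ℝ≥0∞) [Fact (1 ≤ p)],
      ‖markovOp ν p - ∑ n ∈ b.support, b n • fourierProj p n‖ ≤ ε := by
  set h : Circle → ℂ := fun y => ((ν.rnDeriv haar y).toReal : ℂ) with hh
  have hint : Integrable h haar := Measure.integrable_toReal_rnDeriv.ofReal
  obtain ⟨b, hb⟩ := exists_trigPoly_near_integrable hint hε
  refine ⟨b, fun p hp => ContinuousLinearMap.opNorm_le_bound _ hε.le fun f => ?_⟩
  have htrig : Integrable (fun y => ∑ n ∈ b.support, b n * character (-n) y) haar :=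
    integrable_finsetSum _ fun n _ => (integrable_character (-n)).const_mul (b n)
  refine (norm_le_of_ae_eq_integral_mul p (hint.sub htrig) ?_).trans
    (mul_le_mul_of_nonneg_right hb (norm_nonneg f))
  rw [sub_apply]
  filter_upwards [Lp.coeFn_sub (markovOp ν p f) ((∑ n ∈ b.support, b n • fourierProj p n) f),
    coeFn_markovOp ν p f, coeFn_sum_fourierProj p b f,
    ae_integrable_shift (μ := ν) hp.out (Lp.memLp f),
    ae_integrable_shift (μ := haar) hp.out (Lp.memLp f)] with x h1 h2 h3 h4 h5
  have hi1 : Integrable (fun y => f (x * y) * h y) haar :=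
    ((integrable_rnDeriv_smul_iff hν).2 h4).congr
      (Eventually.of_forall fun y => by simp [hh, mul_comm])
  have hi2 : ∀ n ∈ b.support, Integrable (fun y => b n * (f (x * y) * character (-n) y)) haar :=
    fun n _ => (integrable_mul_character h5 (-n)).const_mul (b n)
  have e1 : ∫ y, f (x * y) * h y ∂haar = markovFun ν f x := by
    rw [markovFun, ← integral_rnDeriv_smul hν]
    exact integral_congr_ae (Eventually.of_forall fun y => by simp [hh, mul_comm])
  have e2 : ∫ y, ∑ n ∈ b.support, b n * (f (x * y) * character (-n) y) ∂haar =
      ∑ n ∈ b.support, b n * (coeffFunctional p n f * character n x) := by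
    rw [integral_finsetSum _ hi2]
    exact Finset.sum_congr rfl fun n _ => by
      rw [integral_const_mul, integral_shift_mul_character]
  rw [h1, Pi.sub_apply, h2, h3, ← e1, ← e2, ← integral_sub hi1 (integrable_finsetSum _ hi2)]
  refine integral_congr_ae (Eventually.of_forall fun y => ?_)
  simp only [mul_sub, Finset.mul_sum, Pi.sub_apply]
  congr 1
  exact Finset.sum_congr rfl fun n _ => by ring

/-! ### Fourier–Stieltjes coefficients of modulus one -/

/-- If `|μ̂(n)| = 1` for some `n ≠ 0`, then `zⁿ` is `μ`-almost surely constant, so that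
`|μ̂(n m)| = 1` for all `m`, and `μ` is not Rajchman. -/
lemma norm_integral_character_lt_one (μ : Measure Circle) [IsProbabilityMeasure μ]
    (hμ : Tendsto (fun n : ℤ => fourierStieltjes μ (-n)) cofinite (𝓝 0)) {n : ℤ} (hn : n ≠ 0) :
    ‖fourierStieltjes μ (-n)‖ < 1 := by
  rw [fourierStieltjes_neg]
  rcases ae_eq_const_or_norm_integral_lt_of_norm_le_const (μ := μ) (f := character n) (C := 1)
    (Eventually.of_forall fun z => (norm_character n z).le) with h | h
  · exfalso
    set u := ⨍ z, character n z ∂μ with hu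
    have hu1 : ‖u‖ = 1 := by
      obtain ⟨z, hz⟩ := h.exists
      rw [Function.const_apply] at hz
      rw [← hz, norm_character]
    have hpow : ∀ m : ℤ, fourierStieltjes μ (-(n * m)) = u ^ m := fun m => by
      rw [fourierStieltjes_neg]
      have : (fun z => character (n * m) z) =ᵐ[μ] fun _ => u ^ m := by
        filter_upwards [h] with z hz
        rw [Function.const_apply] at hz
        rw [← hz, character_apply, character_apply, zpow_mul]
      rw [integral_congr_ae this]
      simp
    have hlim := (hμ.comp (mul_right_injective₀ hn).tendsto_cofinite).norm
    have hone : ∀ m : ℤ, ‖fourierStieltjes μ (-(n * m))‖ = 1 := fun m => by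
      rw [hpow, norm_zpow, hu1, one_zpow]
    simp only [Function.comp_def, hone, norm_zero] at hlim
    exact one_ne_zero (tendsto_nhds_unique tendsto_const_nhds hlim)
  · simpa using h

end CircleConv

open CircleConv in
theorem mainTheorem5 (μ : Measure Circle) [IsProbabilityMeasure μ] (k : ℕ) (hk : 1 ≤ k)
    (hac : CircleConv.convPow μ k ≪ CircleConv.haar) :
    CircleConv.IsRajchman μ ∧
    (∀ (p : ℝ≥0∞) [Fact (1 ≤ p)],
      Tendsto (fun n : ℕ => ‖CircleConv.markovOp μ p ^ n - CircleConv.expectationOp p‖)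
        atTop (𝓝 0)) ∧
    (∀ (p : ℝ≥0∞) [Fact (1 ≤ p)],
      spectrum ℂ (CircleConv.markovOp μ p) = spectrum ℂ (CircleConv.markovOp μ 2)) := by
  have hk0 : k ≠ 0 := by omega
  have happ : ∀ ε > 0, ∃ b : ℤ →₀ ℂ, ∀ (p : ℝ≥0∞) [Fact (1 ≤ p)],
      ‖markovOp μ p ^ k - ∑ n ∈ b.support, b n • fourierProj p n‖ ≤ ε := fun ε hε => by
    obtain ⟨b, hb⟩ := exists_norm_markovOp_sub_le (convPow μ k) hac hε
    exact ⟨b, fun p hp => by rw [← markovOp_convPow]; exact hb p⟩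
  have happ' : ∀ (p : ℝ≥0∞) [Fact (1 ≤ p)], ∀ ε > 0, ∃ b : ℤ →₀ ℂ,
      ‖markovOp μ p ^ k - ∑ n ∈ b.support, b n • fourierProj p n‖ ≤ ε := fun p hp ε hε =>
    (happ ε hε).imp fun b hb => hb p
  have hdecay : Tendsto (fun n : ℤ => fourierStieltjes μ (-n)) cofinite (𝓝 0) :=
    (isDiagonalOn_markovOp μ 2).tendsto_eigenvalue hk0 (happ' 2)
  refine ⟨?_, fun p hp => ?_, fun p hp => ?_⟩
  · have h1 := hdecay.comp (neg_injective (G := ℤ)).tendsto_cofinite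
    simp only [Function.comp_def, neg_neg] at h1
    rw [IsRajchman, Filter.comap_abs_atTop, ← Int.cofinite_eq]
    exact h1
  · obtain ⟨b, hb⟩ := happ' p (1 / 2) (by norm_num)
    rw [← fourierProj_zero]
    refine (isDiagonalOn_markovOp μ p).tendsto_pow hk0 (norm_markovOp_le μ p) ?_
      (fun n hn => norm_integral_character_lt_one μ hdecay hn) b (hb.trans_lt (by norm_num))
    simp [fourierStieltjes]
  · rw [(isDiagonalOn_markovOp μ p).spectrum_eq hk0 (happ' p),
      (isDiagonalOn_markovOp μ 2).spectrum_eq hk0 (happ' 2)]
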